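/- Let $E$ be a number field with ring of integers $\mathfrak{O}$, let $\lambda$ be a maximal ideal of $\mathfrak{O}$ with residue field $k(\lambda)=\mathfrak{O}/\lambda$ of characteristic $\ell$, and assume that $\lambda$ is the only maximal ideal of $\mathfrak{O}$ containing $\ell$. Let $K$ be a field with $\mathrm{char}(K)\neq\ell$, let $K_a$ be an algebraic closure of $K$ and $\mathrm{Gal}(K)=\mathrm{Aut}(K_a/K)$. Let $X$ and $Y$ be abelian varieties of positive dimension over $K$, provided with ring embeddings $i:E\hookrightarrow \mathrm{End}_K(X)\otimes\mathbf{Q}$ and $j:E\hookrightarrow\mathrm{End}_K(Y)\otimes\mathbf{Q}$ that send $1$ to $1_X$ and $1_Y$ respectively and satisfy $i(\mathfrak{O})\subset\mathrm{End}_K(X)$, $j(\mathfrak{O})\subset\mathrm{End}_K(Y)$. Put $X_\lambda=\{x\in X(K_a)\mid i(e)x=0\ \ \forall e\in\lambda\}$ and $Y_\lambda=\{y\in Y(K_a)\mid j(e)y=0\ \ \forall e\in\lambda\}$. These are $k(\lambda)$-vector spaces on which $\mathrm{Gal}(K)$ acts $k(\lambda)$-linearly. Let $K(X_\lambda)\subset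 K_a$ (resp. $K(Y_\lambda)\subset K_a$) be the field of definition over $K$ of all points of $X_\lambda$ (resp. of $Y_\lambda$). Let $k_1$ be the centralizer of (the image of) $\mathrm{Gal}(K)$ in $\mathrm{End}_{k(\lambda)}(X_\lambda)$ and $k_2$ the centralizer of $\mathrm{Gal}(K)$ in $\mathrm{End}_{k(\lambda)}(Y_\lambda)$. Suppose that (i) the extensions $K(X_\lambda)$ and $K(Y_\lambda)$ are linearly disjoint over $K$; (ii) the $k(\lambda)$-algebras $k_1$ and $k_2$ are fields that are linearly disjoint over $k(\lambda)$ (i.e. they embed over $k(\lambda)$ in a common field with linearly disjoint images). Then $(X,i)$ and $(Y,j)$ are disjoint at $\lambda$ over $K$, that is: the centralizer of $\mathrm{Gal}(K)$ in $\mathrm{End}_{k(\lambda)}\bigl(\mathrm{Hom}_{k(\lambda)}(X_\lambda,Y_\lambda)\bigr)$ is a field, where $\sigma\in\mathrm{Gal}(K)$ acts on $\mathrm{Hom}_{k(\lambda)}(X_\lambda,Y_\lambda)$ by $u\mapsto\sigma u\sigma^{-1}$. -/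

import Mathlib

open AlgebraicGeometry CategoryTheory
open scoped NumberField

universe u v

noncomputable section

open scoped TensorProduct MonObj

/-! ### Abelian varieties and their endomorphism rings -/

/-- An abelian variety over a field `K`: a proper, geometrically integral group scheme over `K`. -/
structure AbelianVariety (K : Type u) [Field K] where
  /-- the underlying `K`-scheme -/
  X : Over (Spec (.of K))
  [grpObj : GrpObj X]
  [isProper : IsProper X.hom]
  [geometricallyIntegral : GeometricallyIntegral X.hom]

namespace AbelianVariety

attribute [instance] grpObj isProper geometricallyIntegral

variable {K : Type u} [Field K]

instance isCommMonObj (A : AbelianVariety K) : IsCommMonObj A.X :=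
  isCommMonObj_of_isProper_of_geometricallyIntegral A.X

/-- The (Krull) dimension of an abelian variety. -/
def dim (A : AbelianVariety K) : WithBot ℕ∞ := topologicalKrullDim A.X.left

/-- The set of `K`-endomorphisms of `A`, i.e. of morphisms `A ⟶ A` of `K`-schemes that are
homomorphisms for the group law. -/
@[ext]
structure EndK (A : AbelianVariety K) : Type u where
  /-- the underlying morphism of `K`-schemes -/
  hom : A.X ⟶ A.X
  [isMonHom : IsMonHom hom]

namespace EndK

attribute [instance] isMonHom

variable {A : AbelianVariety K}

theorem isMonHom_one : IsMonHom (1 : A.X ⟶ A.X) :=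
  inferInstanceAs (IsMonHom (SemiCartesianMonoidalCategory.toUnit A.X ≫ MonObj.one))

theorem isMonHom_mul (f g : A.X ⟶ A.X) [IsMonHom f] [IsMonHom g] : IsMonHom (f * g) :=
  inferInstanceAs (IsMonHom (CartesianMonoidalCategory.lift f g ≫ MonObj.mul))

instance : Zero A.EndK := ⟨{ hom := 1, isMonHom := isMonHom_one }⟩
instance : One A.EndK := ⟨{ hom := 𝟙 A.X }⟩
instance : Add A.EndK := ⟨fun f g => { hom := f.hom * g.hom, isMonHom := isMonHom_mul f.hom g.hom }⟩
instance : Neg A.EndK := ⟨fun f => { hom := f.hom⁻¹ }⟩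
instance : Mul A.EndK := ⟨fun f g => { hom := g.hom ≫ f.hom }⟩

/-- `EndK A` is a ring: addition comes from the group law of `A` (which Mathlib writes
multiplicatively on morphisms), multiplication is composition. -/
instance : Ring A.EndK where
  add_assoc f g h := EndK.ext (mul_assoc f.hom g.hom h.hom)
  zero_add f := EndK.ext (one_mul f.hom)
  add_zero f := EndK.ext (mul_one f.hom)
  add_comm f g := EndK.ext (mul_comm f.hom g.hom)
  neg_add_cancel f := EndK.ext (inv_mul_cancel f.hom)
  mul_assoc f g h := EndK.ext (Category.assoc h.hom g.hom f.hom).symm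
  one_mul f := EndK.ext (Category.comp_id f.hom)
  mul_one f := EndK.ext (Category.id_comp f.hom)
  zero_mul f := EndK.ext (MonObj.comp_one f.hom)
  mul_zero f := EndK.ext (MonObj.one_comp f.hom)
  left_distrib f g h := EndK.ext (MonObj.mul_comp g.hom h.hom f.hom)
  right_distrib f g h := EndK.ext (MonObj.comp_mul h.hom f.hom g.hom)
  nsmul := nsmulRec
  zsmul := zsmulRec

end EndK

/-- `End⁰_K(A) = ℚ ⊗ End_K(A)`. -/
abbrev EndK₀ (A : AbelianVariety K) : Type u := ℚ ⊗[ℤ] A.EndK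

end AbelianVariety

/-! ### Points with values in a `K`-algebra -/

/-- `Spec R` as a `K`-scheme, for a `K`-algebra `R`. -/
def specOver (K : Type u) [Field K] (R : Type u) [CommRing R] [Algebra K R] :
    Over (Spec (.of K)) :=
  Over.mk (Spec.map (CommRingCat.ofHom (algebraMap K R)))

/-- The morphism `Spec S ⟶ Spec R` of `K`-schemes given by a homomorphism `R → S` of
`K`-algebras. -/
def specOverMap {K : Type u} [Field K] {R S : Type u} [CommRing R] [Algebra K R]
    [CommRing S] [Algebra K S] (f : R →ₐ[K] S) : specOver K S ⟶ specOver K R :=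
  Over.homMk (Spec.map (CommRingCat.ofHom f.toRingHom)) (by
    simp only [specOver, Over.mk_hom, ← Spec.map_comp, ← CommRingCat.ofHom_comp]
    congr 2
    exact f.comp_algebraMap)

theorem specOverMap_id {K : Type u} [Field K] (R : Type u) [CommRing R] [Algebra K R] :
    specOverMap (AlgHom.id K R) = 𝟙 (specOver K R) := by
  ext1
  exact Spec.map_id _

theorem specOverMap_comp {K : Type u} [Field K] {R S T : Type u} [CommRing R] [Algebra K R]
    [CommRing S] [Algebra K S] [CommRing T] [Algebra K T] (g : S →ₐ[K] T) (f : R →ₐ[K] S) :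
    specOverMap (g.comp f) = specOverMap g ≫ specOverMap f := by
  ext1
  exact Spec.map_comp (CommRingCat.ofHom f.toRingHom) (CommRingCat.ofHom g.toRingHom)

/-! ### Abelian varieties with multiplication by a number field -/

/-- A pair `(X, i)`: an abelian variety `X` over `K` with an embedding `i : E ↪ End⁰_K(X)` of rings
(sending `1` to `1`) such that `i(𝓞 E) ⊆ End_K(X)`; `iO` is the restriction `𝓞 E → End_K(X)`. -/
structure AbelianVarietyWithMul (K : Type u) [Field K] (E : Type v) [Field E] [NumberField E]
    extends AbelianVariety K where
  /-- the embedding `E ↪ End⁰_K(X)` -/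
  i : E →+* toAbelianVariety.EndK₀
  i_injective : Function.Injective i
  /-- the restriction of `i` to the ring of integers, with values in `End_K(X)` -/
  iO : 𝓞 E →+* toAbelianVariety.EndK
  i_eq : ∀ a : 𝓞 E, i (a : E) = 1 ⊗ₜ[ℤ] iO a

namespace AbelianVarietyWithMul

variable {K : Type u} [Field K] {E : Type v} [Field E] [NumberField E]

/-- The group `X(R)` of `R`-valued points of `X`, written additively, for a `K`-algebra `R`. -/
def Points (A : AbelianVarietyWithMul K E) (R : Type u) [CommRing R] [Algebra K R] : Type u :=
  Additive (specOver K R ⟶ A.X)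

section Points

variable (A : AbelianVarietyWithMul K E) (R : Type u) [CommRing R] [Algebra K R]

instance : AddCommGroup (A.Points R) :=
  inferInstanceAs (AddCommGroup (Additive (specOver K R ⟶ A.X)))

/-- The action of `𝓞 E` on `X(R)`, `a • x = i(a)(x)`. -/
instance : Module (𝓞 E) (A.Points R) where
  smul a x := Additive.ofMul (x.toMul ≫ (A.iO a).hom)
  one_smul x := by
    change Additive.ofMul (x.toMul ≫ (A.iO 1).hom) = x
    rw [map_one]
    exact congrArg Additive.ofMul (Category.comp_id x.toMul)
  mul_smul a b x := by
    change Additive.ofMul (x.toMul ≫ (A.iO (a * b)).hom) =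
      Additive.ofMul ((x.toMul ≫ (A.iO b).hom) ≫ (A.iO a).hom)
    rw [map_mul]
    exact congrArg Additive.ofMul (Category.assoc x.toMul (A.iO b).hom (A.iO a).hom).symm
  smul_zero a := congrArg Additive.ofMul (MonObj.one_comp (A.iO a).hom)
  smul_add a x y := congrArg Additive.ofMul (MonObj.mul_comp x.toMul y.toMul (A.iO a).hom)
  add_smul a b x := by
    change Additive.ofMul (x.toMul ≫ (A.iO (a + b)).hom) = _
    rw [map_add]
    exact congrArg Additive.ofMul (MonObj.comp_mul x.toMul (A.iO a).hom (A.iO b).hom)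
  zero_smul x := by
    change Additive.ofMul (x.toMul ≫ (A.iO 0).hom) = _
    rw [map_zero]
    exact congrArg Additive.ofMul (MonObj.comp_one x.toMul)

end Points

/-- A homomorphism `f : R → S` of `K`-algebras induces an `𝓞 E`-linear map `X(R) → X(S)`. -/
def pointsMap (A : AbelianVarietyWithMul K E) {R S : Type u} [CommRing R] [Algebra K R]
    [CommRing S] [Algebra K S] (f : R →ₐ[K] S) : A.Points R →ₗ[𝓞 E] A.Points S where
  toFun x := Additive.ofMul (specOverMap f ≫ x.toMul)
  map_add' x y := congrArg Additive.ofMul (MonObj.comp_mul (specOverMap f) x.toMul y.toMul)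
  map_smul' a x :=
    congrArg Additive.ofMul (Category.assoc (specOverMap f) x.toMul (A.iO a).hom).symm

theorem pointsMap_id (A : AbelianVarietyWithMul K E) (R : Type u) [CommRing R] [Algebra K R] :
    A.pointsMap (AlgHom.id K R) = LinearMap.id := by
  ext x
  change Additive.ofMul (specOverMap (AlgHom.id K R) ≫ x.toMul) = x
  rw [specOverMap_id]
  exact congrArg Additive.ofMul (Category.id_comp x.toMul)

theorem pointsMap_comp (A : AbelianVarietyWithMul K E) {R S T : Type u} [CommRing R] [Algebra K R]
    [CommRing S] [Algebra K S] [CommRing T] [Algebra K T] (g : S →ₐ[K] T) (f : R →ₐ[K] S) :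
    A.pointsMap (g.comp f) = A.pointsMap g ∘ₗ A.pointsMap f := by
  ext x
  change Additive.ofMul (specOverMap (g.comp f) ≫ x.toMul) =
    Additive.ofMul (specOverMap g ≫ specOverMap f ≫ x.toMul)
  rw [specOverMap_comp, Category.assoc]

/-! ### The Galois representation on `X_λ` -/

section Torsion

variable (A : AbelianVarietyWithMul K E) (Ka : Type u) [Field Ka] [Algebra K Ka]
  (lam : Ideal (𝓞 E))

/-- `X_λ = {x ∈ X(K_a) | i(e) x = 0 for all e ∈ λ}`. -/
def lamSubmodule : Submodule (𝓞 E) (A.Points Ka) :=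
  Submodule.torsionBySet (𝓞 E) (A.Points Ka) (lam : Set (𝓞 E))

/-- `X_λ` as a type. -/
abbrev Lam : Type u := A.lamSubmodule Ka lam

/-- The natural `k(λ) = 𝓞 E ⧸ λ`-vector space structure on `X_λ`. -/
instance : Module (𝓞 E ⧸ lam) (A.Lam Ka lam) :=
  (Submodule.torsionBySet_isTorsionBySet (M := A.Points Ka) (lam : Set (𝓞 E))).module

theorem mk_smul_lam (a : 𝓞 E) (x : A.Lam Ka lam) : Ideal.Quotient.mk lam a • x = a • x := rfl

/-- `X_λ` is stable under the Galois action. -/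
theorem pointsMap_mem_lam (σ : Ka ≃ₐ[K] Ka) (x : A.Points Ka) (hx : x ∈ A.lamSubmodule Ka lam) :
    A.pointsMap (σ : Ka →ₐ[K] Ka) x ∈ A.lamSubmodule Ka lam := by
  rw [lamSubmodule, Submodule.mem_torsionBySet_iff] at hx ⊢
  intro a
  rw [← map_smul, hx a, map_zero]

/-- The representation of `Gal(K) = Aut(K_a/K)` on the `k(λ)`-vector space `X_λ`. -/
def galRep : Representation (𝓞 E ⧸ lam) (Ka ≃ₐ[K] Ka) (A.Lam Ka lam) where
  toFun σ :=
    { toFun := fun x => ⟨A.pointsMap (σ : Ka →ₐ[K] Ka) x, A.pointsMap_mem_lam Ka lam σ x x.2⟩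
      map_add' := fun x y => Subtype.ext (map_add (A.pointsMap (σ : Ka →ₐ[K] Ka)) x.1 y.1)
      map_smul' := fun c x => by
        obtain ⟨a, rfl⟩ := Ideal.Quotient.mk_surjective c
        exact Subtype.ext (map_smul (A.pointsMap (σ : Ka →ₐ[K] Ka)) a x.1) }
  map_one' := by
    ext x
    exact congrArg (fun f => f x.1) (A.pointsMap_id Ka)
  map_mul' σ τ := by
    ext x
    exact congrArg (fun f => f x.1) (A.pointsMap_comp (σ : Ka →ₐ[K] Ka) (τ : Ka →ₐ[K] Ka))

/-- `K(X_λ)`, the field of definition of all points of `X_λ`: the smallest field `L` with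
`K ⊆ L ⊆ K_a` such that all points of `X_λ` come from `X(L)`. -/
def fieldOfDefinition : IntermediateField K Ka :=
  sInf {L : IntermediateField K Ka |
    ∀ x ∈ A.lamSubmodule Ka lam, x ∈ Set.range (A.pointsMap L.val)}

/-- The centralizer of the Galois group in `End_{k(λ)}(X_λ)`. -/
def galCentralizer : Subalgebra (𝓞 E ⧸ lam) (Module.End (𝓞 E ⧸ lam) (A.Lam Ka lam)) :=
  Subalgebra.centralizer (𝓞 E ⧸ lam) (Set.range (A.galRep Ka lam))

end Torsion

section Disjoint

variable (A B : AbelianVarietyWithMul K E) (Ka : Type u) [Field Ka] [Algebra K Ka]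
  (lam : Ideal (𝓞 E))

/-- The centralizer of the Galois group in `End_{k(λ)}(Hom_{k(λ)}(X_λ, Y_λ))`, where `σ` acts on
`Hom_{k(λ)}(X_λ, Y_λ)` by `u ↦ σ ∘ u ∘ σ⁻¹`. -/
def homCentralizer : Subalgebra (𝓞 E ⧸ lam)
    (Module.End (𝓞 E ⧸ lam) (A.Lam Ka lam →ₗ[𝓞 E ⧸ lam] B.Lam Ka lam)) :=
  Subalgebra.centralizer (𝓞 E ⧸ lam)
    (Set.range ((A.galRep Ka lam).linHom (B.galRep Ka lam)))

/-- `(X, i)` and `(Y, j)` are disjoint at `λ` over `K`. -/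
def DisjointAt : Prop := IsField (A.homCentralizer B Ka lam)

end Disjoint

end AbelianVarietyWithMul

/-- Two field extensions `F₁`, `F₂` of `F` (not given inside a common field) are linearly disjoint
over `F`: they embed over `F` in a common field with linearly disjoint images. For algebraic
extensions, the choice of the common field and of the embeddings does not matter. -/
def LinearlyDisjointOver (F : Type v) [CommRing F] (F₁ F₂ : Type u) [Ring F₁] [Algebra F F₁]
    [Ring F₂] [Algebra F F₂] : Prop :=
  ∃ (Ω : Type u) (_ : Field Ω) (_ : Algebra F Ω) (f : F₁ →ₐ[F] Ω) (g : F₂ →ₐ[F] Ω),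
    f.range.LinearDisjoint g.range

end

/-! Write k = k(λ), V = X_λ, W = Y_λ. Galois acts on V and W through restriction to K(X_λ) and
K(Y_λ). As these fields are linearly disjoint, the two actions can be prescribed independently
(`exists_algEquiv_eqOn`, `galRep_congr`). So an endomorphism of Hom(V, W) commuting with Galois
commutes separately with precomposition by the image of Galois in GL(V) and with postcomposition by
its image in GL(W). Since Hom(V, W) = V* ⊗ W, it comes from k₁ ⊗ k₂ (`mem_range_homTensorAction`).
This tensor product is a finite-dimensional algebra embedded in a field, hence a field, and so is
its nonzero image.

This needs V and W finite-dimensional. They are even finite: ℓ is invertible in K, so multiplication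
by ℓ is unramified and its kernel is finite over K (`finite_torsion_points`). Unramifiedness rests
on the fact that, to first order at the unit, the group law is addition
(`specOverMap_map_fst_add_snd`). -/

noncomputable section

open scoped TensorProduct MonObj

/-! ### Centralizers in End(Hom(V, W)) -/

section LinearAlgebra

variable {k : Type v} [Field k]

/-- The tensor product of finite-dimensional algebras that are linearly disjoint is a field. -/
theorem LinearlyDisjointOver.isField_tensorProduct {F₁ F₂ : Type u} [Ring F₁] [Algebra k F₁]
    [Ring F₂] [Algebra k F₂] [Module.Finite k F₁] [Module.Finite k F₂]
    (h₁ : IsField F₁) (h₂ : IsField F₂) (h : LinearlyDisjointOver k F₁ F₂) :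
    IsField (F₁ ⊗[k] F₂) := by
  obtain ⟨Ω, _, _, f, g, hfg⟩ := h
  have hf : Function.Injective f := by
    let := h₁.toField
    exact RingHom.injective (f : F₁ →+* Ω)
  have hg : Function.Injective g := by
    let := h₂.toField
    exact RingHom.injective (g : F₂ →+* Ω)
  have hc (x y) : Commute (f x) (g y) := mul_comm _ _
  let e : F₁ ⊗[k] F₂ →ₐ[k] Ω := Algebra.TensorProduct.lift f g hc
  have he : Function.Injective e := by
    have h1 : Function.Injective (f.range.mulMap g.range) :=
      Subalgebra.linearDisjoint_iff_injective.mp hfg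
    let e₁ := AlgEquiv.ofInjective f hf
    let e₂ := AlgEquiv.ofInjective g hg
    have h2 : e = (f.range.mulMap g.range).comp
        (Algebra.TensorProduct.congr e₁ e₂ : F₁ ⊗[k] F₂ →ₐ[k] f.range ⊗[k] g.range) := by
      ext x
      · exact (Algebra.TensorProduct.lift_tmul f g hc x 1).trans (by simp [e₁, e₂])
      · exact (Algebra.TensorProduct.lift_tmul f g hc 1 x).trans (by simp [e₁, e₂])
    rw [h2]
    exact h1.comp (Algebra.TensorProduct.congr e₁ e₂).injective
  have hcomm (x y : F₁ ⊗[k] F₂) : x * y = y * x := he (by rw [map_mul, map_mul, mul_comm])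
  obtain ⟨x₁, y₁, h₁'⟩ := h₁.exists_pair_ne
  have : Nontrivial F₁ := ⟨x₁, y₁, h₁'⟩
  obtain ⟨x₂, y₂, h₂'⟩ := h₂.exists_pair_ne
  have : Nontrivial F₂ := ⟨x₂, y₂, h₂'⟩
  refine ⟨exists_pair_ne _, hcomm, fun {a} ha => ?_⟩
  -- The algebra embeds in the field Ω, so multiplication by `a ≠ 0` is injective, hence surjective
  -- by finite dimension.
  have hinj : Function.Injective (LinearMap.mulLeft k a) := fun x y hxy => by
    have := congrArg e hxy
    simp only [LinearMap.mulLeft_apply, map_mul] at this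
    exact he (mul_left_cancel₀ ((map_ne_zero_iff e he).mpr ha) this)
  obtain ⟨b, hb⟩ := LinearMap.injective_iff_surjective.mp hinj 1
  exact ⟨b, hb⟩

variable {V W : Type u} [AddCommGroup V] [Module k V] [AddCommGroup W] [Module k W]

/-- Left and right composition on `Hom(V, W)` by commuting subalgebras of endomorphisms. -/
def homTensorAction (C₁ : Subalgebra k (Module.End k V)) (C₂ : Subalgebra k (Module.End k W))
    (h : ∀ a b : C₁, a * b = b * a) : C₁ ⊗[k] C₂ →ₐ[k] Module.End k (V →ₗ[k] W) :=
  Algebra.TensorProduct.lift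
    { toFun := fun a => LinearMap.lcomp k W a.1
      map_one' := rfl
      -- Precomposition reverses products; commutativity of `C₁` makes it a homomorphism.
      map_mul' := fun a b => by rw [h]; rfl
      map_zero' := by ext; simp
      map_add' := fun a b => by ext; simp
      commutes' := fun r => by ext; simp [Module.algebraMap_end_apply] }
    { toFun := fun b => LinearMap.compRight k b.1
      map_one' := rfl
      map_mul' := fun a b => rfl
      map_zero' := by ext; simp
      map_add' := fun a b => by ext; simp
      commutes' := fun r => by ext; simp [Module.algebraMap_end_apply] }
    fun _ _ => rfl

theorem homTensorAction_tmul (C₁ : Subalgebra k (Module.End k V))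
    (C₂ : Subalgebra k (Module.End k W)) (h : ∀ a b : C₁, a * b = b * a) (a : C₁) (b : C₂)
    (u : V →ₗ[k] W) : homTensorAction C₁ C₂ h (a ⊗ₜ b) u = b.1 ∘ₗ u ∘ₗ a.1 := rfl

/-- An endomorphism of `Hom(V, W)` that commutes with the left and right compositions by `S` and
`R` is a sum of products of such compositions by elements of the centralizers. -/
theorem mem_range_homTensorAction [FiniteDimensional k V] [FiniteDimensional k W]
    (R : Set (Module.End k V)) (S : Set (Module.End k W))
    (h : ∀ a b : Subalgebra.centralizer k R, a * b = b * a) (T : Module.End k (V →ₗ[k] W))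
    (hR : ∀ r ∈ R, ∀ u, T (u ∘ₗ r) = T u ∘ₗ r) (hS : ∀ s ∈ S, ∀ u, T (s ∘ₗ u) = s ∘ₗ T u) :
    T ∈ (homTensorAction (Subalgebra.centralizer k R) (Subalgebra.centralizer k S) h).range := by
  classical
  let e := Module.finBasis k V
  let b := Module.finBasis k (Subalgebra.centralizer k S)
  -- The basis of V identifies Hom(V, W) with a power of W, and T with a matrix of endomorphisms of
  -- W; by `hS` its entries centralize `S`.
  let t (i j) : Subalgebra.centralizer k S :=
    ⟨LinearMap.applyₗ (e j) ∘ₗ T ∘ₗ LinearMap.smulRightₗ (e.coord i), by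
      rw [Subalgebra.mem_centralizer_iff]
      intro s hs
      ext w
      have h1 := congrArg (fun f => f (e j)) (hS s hs (LinearMap.smulRight (e.coord i) w))
      have h2 : s ∘ₗ LinearMap.smulRight (e.coord i) w = LinearMap.smulRight (e.coord i) (s w) := by
        ext; simp
      rw [h2] at h1
      exact h1.symm⟩
  have ht (i j w) : (t i j).1 w = T (LinearMap.smulRight (e.coord i) w) (e j) := rfl
  -- Expanding each entry in the basis `b`, the coefficients of `b s` form a matrix over k, that is,
  -- an endomorphism of V.
  let M (s) : Module.End k V := e.constr k fun j => ∑ i, b.repr (t i j) s • e i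
  have hT (u : V →ₗ[k] W) : T u = ∑ s, (b s).1 ∘ₗ u ∘ₗ M s := by
    have hu : u = ∑ i, LinearMap.smulRight (e.coord i) (u (e i)) := by
      refine e.ext fun j => ?_
      simp [Finsupp.single_apply, LinearMap.sum_apply]
    refine e.ext fun j => ?_
    conv_lhs => rw [hu]
    have h3 (i) (w : W) : (t i j).1 w = ∑ s, b.repr (t i j) s • (b s).1 w := by
      have h4 := congrArg (fun f => f.1 w) (b.sum_repr (t i j)).symm
      simp only [AddSubmonoidClass.coe_finsetSum, LinearMap.sum_apply] at h4
      exact h4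
    simp only [map_sum, LinearMap.sum_apply, ← ht, h3]
    rw [Finset.sum_comm]
    simp [M]
  have hM (s) : M s ∈ Subalgebra.centralizer k R := by
    rw [Subalgebra.mem_centralizer_iff]
    intro r hr
    ext v
    rw [← sub_eq_zero, ← Module.forall_dual_apply_eq_zero_iff k]
    intro φ
    -- This is `hR` tested on the rank-one maps φ ⊗ w; independence of the `b s` then kills every
    -- coefficient.
    have hzero : ∑ s, φ ((r * M s) v - (M s * r) v) • b s = 0 := by
      refine Subtype.ext (LinearMap.ext fun w => ?_)
      have := congrArg (fun f => f v) (hR r hr (LinearMap.smulRight φ w))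
      simp only [hT, LinearMap.sum_apply, LinearMap.comp_apply, LinearMap.smulRight_apply,
        map_smul] at this
      simp [LinearMap.sum_apply, sub_smul, Finset.sum_sub_distrib, this]
    exact Fintype.linearIndependent_iff.mp b.linearIndependent _ hzero s
  refine ⟨∑ s, ⟨M s, hM s⟩ ⊗ₜ b s, ?_⟩
  refine LinearMap.ext fun u => ?_
  rw [hT, AlgHom.toRingHom_eq_coe, AlgHom.coe_toRingHom, map_sum, LinearMap.sum_apply]
  rfl

/-- If the image of `G` in `GL(V) × GL(W)` is the product of its projections and the centralizers
of `G` in `End(V)` and `End(W)` are linearly disjoint fields, then the centralizer of `G` in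
`End(Hom(V, W))` is a field. -/
theorem isField_centralizer_linHom [FiniteDimensional k V] [FiniteDimensional k W]
    {G : Type*} [Group G] (ρ : Representation k G V) (θ : Representation k G W)
    (hprod : ∀ σ τ : G, ∃ g, ρ g = ρ σ ∧ θ g = θ τ)
    (h₁ : IsField (Subalgebra.centralizer k (Set.range ρ)))
    (h₂ : IsField (Subalgebra.centralizer k (Set.range θ)))
    (h : LinearlyDisjointOver k (Subalgebra.centralizer k (Set.range ρ))
      (Subalgebra.centralizer k (Set.range θ))) :
    IsField (Subalgebra.centralizer k (Set.range (ρ.linHom θ))) := by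
  have hF := h.isField_tensorProduct h₁ h₂
  let Φ := homTensorAction _ (Subalgebra.centralizer k (Set.range θ)) h₁.mul_comm
  have hΦ (x) : Φ x ∈ Subalgebra.centralizer k (Set.range (ρ.linHom θ)) := by
    rw [Subalgebra.mem_centralizer_iff]
    rintro _ ⟨g, rfl⟩
    induction x with
    | zero => simp
    | add x y hx hy => rw [map_add, mul_add, add_mul, hx, hy]
    | tmul a b =>
      refine LinearMap.ext fun u => LinearMap.ext fun v => ?_
      have ha := congrArg (fun f => f v)
        ((Subalgebra.mem_centralizer_iff k).mp a.2 _ ⟨g⁻¹, rfl⟩)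
      have hb (w) := congrArg (fun f => f w)
        ((Subalgebra.mem_centralizer_iff k).mp b.2 _ ⟨g, rfl⟩)
      simp only [Module.End.mul_apply] at ha hb
      simp only [Φ, Module.End.mul_apply, homTensorAction_tmul, Representation.linHom_apply,
        LinearMap.comp_apply, ha, hb]
  have hsurj (T) (hT : T ∈ Subalgebra.centralizer k (Set.range (ρ.linHom θ))) :
      ∃ x, Φ x = T := by
    have hT' (σ τ : G) (u) : T (θ τ ∘ₗ u ∘ₗ ρ σ) = θ τ ∘ₗ T u ∘ₗ ρ σ := by
      -- The inverse appears because `g` acts on Hom(V, W) by precomposition with `ρ g⁻¹`.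
      obtain ⟨g, hg₁, hg₂⟩ := hprod σ⁻¹ τ
      have hg₃ : ρ g⁻¹ = ρ σ := by
        have h4 : ρ g⁻¹ * ρ g = 1 := by rw [← map_mul]; simp
        have h5 : ρ σ⁻¹ * ρ σ = 1 := by rw [← map_mul]; simp
        rw [hg₁] at h4
        exact left_inv_eq_right_inv h4 h5
      have := congrArg (fun f => f u) ((Subalgebra.mem_centralizer_iff k).mp hT _ ⟨g, rfl⟩)
      simpa [hg₂, hg₃, Representation.linHom_apply] using this.symm
    refine mem_range_homTensorAction _ _ h₁.mul_comm T ?_ ?_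
    · rintro _ ⟨σ, rfl⟩ u
      simpa [Module.End.one_eq_id] using hT' σ 1 u
    · rintro _ ⟨τ, rfl⟩ u
      simpa [Module.End.one_eq_id] using hT' 1 τ u
  let Ψ := Φ.codRestrict _ hΦ
  have hΨ : Function.Surjective Ψ := fun T => by
    obtain ⟨x, hx⟩ := hsurj T.1 T.2
    exact ⟨x, Subtype.ext hx⟩
  -- V and W are nonzero because their centralizers are fields; so Hom(V, W) is nonzero and its
  -- centralizer is a nontrivial ring.
  have hV : Nontrivial V := by
    by_contra hV
    rw [not_nontrivial_iff_subsingleton] at hV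
    obtain ⟨x, y, hxy⟩ := h₁.exists_pair_ne
    exact hxy (Subsingleton.elim _ _)
  have hW : Nontrivial W := by
    by_contra hW
    rw [not_nontrivial_iff_subsingleton] at hW
    obtain ⟨x, y, hxy⟩ := h₂.exists_pair_ne
    exact hxy (Subsingleton.elim _ _)
  refine ⟨exists_pair_ne _, fun x y => ?_, fun {x} hx => ?_⟩
  · obtain ⟨x, rfl⟩ := hΨ x
    obtain ⟨y, rfl⟩ := hΨ y
    rw [← map_mul, hF.mul_comm, map_mul]
  · obtain ⟨x, rfl⟩ := hΨ x
    obtain ⟨y, hy⟩ := hF.mul_inv_cancel (a := x) fun h0 => hx (by rw [h0, map_zero])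
    exact ⟨Ψ y, by rw [← map_mul, hy, map_one]⟩

end LinearAlgebra

/-! ### Gluing automorphisms over linearly disjoint subfields -/

section LinearDisjoint

variable {K : Type u} [Field K] {Ka : Type u} [Field Ka] [Algebra K Ka] [IsAlgClosure K Ka]

/-- Automorphisms of the algebraic closure can be prescribed independently on linearly disjoint
subextensions. -/
theorem IntermediateField.LinearDisjoint.exists_algEquiv_eqOn {L₁ L₂ : IntermediateField K Ka}
    (h : L₁.LinearDisjoint L₂) (σ τ : Ka ≃ₐ[K] Ka) :
    ∃ g : Ka ≃ₐ[K] Ka, (∀ x ∈ L₁, g x = σ x) ∧ ∀ x ∈ L₂, g x = τ x := by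
  have : Algebra.IsAlgebraic K Ka := IsAlgClosure.isAlgebraic
  have : IsAlgClosed Ka := IsAlgClosure.isAlgClosed K
  -- Linear disjointness identifies L₁ ⊗ L₂ with its image in `Ka`, a field by algebraicity. Hence σ
  -- on L₁ and τ on L₂ glue there, and the result extends to `Ka`.
  let m := L₁.toSubalgebra.mulMap L₂.toSubalgebra
  have hm : Function.Injective m := Subalgebra.linearDisjoint_iff_injective.mp
    (IntermediateField.linearDisjoint_iff'.mp h)
  let em := AlgEquiv.ofInjective m hm
  let S : IntermediateField K Ka := Subalgebra.IsAlgebraic.toIntermediateField (S := m.range)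
    (fun x _ => Algebra.IsAlgebraic.isAlgebraic x)
  let σ₁ : L₁.toSubalgebra →ₐ[K] Ka := (σ : Ka →ₐ[K] Ka).comp L₁.toSubalgebra.val
  let τ₂ : L₂.toSubalgebra →ₐ[K] Ka := (τ : Ka →ₐ[K] Ka).comp L₂.toSubalgebra.val
  have hc (a b) : Commute (σ₁ a) (τ₂ b) := mul_comm _ _
  let f : L₁.toSubalgebra ⊗[K] L₂.toSubalgebra →ₐ[K] Ka := Algebra.TensorProduct.lift σ₁ τ₂ hc
  have hf (a b) : f (a ⊗ₜ b) = σ₁ a * τ₂ b := Algebra.TensorProduct.lift_tmul σ₁ τ₂ hc a b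
  let f' : S →ₐ[K] Ka := f.comp em.symm.toAlgHom
  obtain ⟨g, hg⟩ := IsAlgClosed.surjective_domRestrict_of_isAlgebraic (E := Ka) f'
  have hg' (t) : g (m t) = f t := by
    have := congrArg (fun φ => φ (em t)) hg
    exact this.trans (congrArg f (em.symm_apply_apply t))
  refine ⟨AlgEquiv.ofBijective g (Algebra.IsAlgebraic.algHom_bijective g), fun x hx => ?_,
    fun x hx => ?_⟩
  · have := hg' (⟨x, hx⟩ ⊗ₜ 1)
    rw [Subalgebra.mulMap_tmul, hf, map_one, mul_one,
      OneMemClass.coe_one, mul_one] at this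
    exact this
  · have := hg' (1 ⊗ₜ ⟨x, hx⟩)
    rw [Subalgebra.mulMap_tmul, hf, map_one, one_mul,
      OneMemClass.coe_one, one_mul] at this
    exact this

end LinearDisjoint

/-! ### Field-valued points and the field of definition -/

section Points

/-- A morphism from the spectrum of a field, as a homomorphism out of a residue field. -/
theorem exists_residueField_hom {F : Type u} [Field F] {X : Scheme.{u}} (x : Spec (.of F) ⟶ X) :
    ∃ φ : X.residueField (x (IsLocalRing.closedPoint F)) ⟶ .of F,
      x = Spec.map φ ≫ X.fromSpecResidueField _ :=
  ⟨_, (Scheme.descResidueField_stalkClosedPointTo_fromSpecResidueField F X x).symm⟩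

variable {K : Type u} [Field K] {Ka : Type u} [Field Ka] [Algebra K Ka]

/-- If a point of a `K`-scheme descends to all the subfields in a set, then it descends to their
intersection. -/
theorem exists_specOverMap_sInf (X : Over (Spec (.of K))) (x : specOver K Ka ⟶ X)
    (𝒮 : Set (IntermediateField K Ka))
    (h : ∀ L ∈ 𝒮, ∃ y : specOver K L ⟶ X, specOverMap L.val ≫ y = x) :
    ∃ y : specOver K (sInf 𝒮 : IntermediateField K Ka) ⟶ X, specOverMap (sInf 𝒮).val ≫ y = x := by
  -- A `Ka`-point is a scheme point `p` with an embedding φ of its residue field. It descends to L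
  -- when φ lands in L, a condition stable under intersection.
  obtain ⟨φ, hφ⟩ := exists_residueField_hom (F := Ka) (X := X.left) x.left
  generalize x.left (IsLocalRing.closedPoint Ka) = p at φ hφ
  have hmem (L) (hL : L ∈ 𝒮) (a) : φ.hom a ∈ L := by
    obtain ⟨y, hy⟩ := h L hL
    obtain ⟨ψ, hψ⟩ := exists_residueField_hom (F := L) (X := X.left) y.left
    generalize y.left (IsLocalRing.closedPoint L) = q at ψ hψ
    have h1 : Spec.map (CommRingCat.ofHom L.val.toRingHom) ≫ y.left = x.left :=
      congrArg Over.Hom.left hy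
    rw [hφ, hψ, ← Spec.map_comp_assoc] at h1
    have hq : q = p := by
      have h2 := congrArg (fun f => f.base (IsLocalRing.closedPoint Ka)) h1
      exact (X.left.fromSpecResidueField_apply q _).symm.trans
        (h2.trans (X.left.fromSpecResidueField_apply p _))
    subst hq
    rw [cancel_mono, Spec.map_inj] at h1
    rw [← h1]
    exact (ψ.hom a).2
  let φ' : X.left.residueField p →+* (sInf 𝒮 : IntermediateField K Ka) :=
    φ.hom.codRestrict _ fun a => by
      rw [IntermediateField.mem_sInf]
      exact fun L hL => hmem L hL a
  have hφ' : CommRingCat.ofHom φ' ≫ CommRingCat.ofHom (sInf 𝒮).val.toRingHom = φ := rfl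
  have hx : Spec.map (CommRingCat.ofHom (sInf 𝒮).val.toRingHom) ≫
      Spec.map (CommRingCat.ofHom φ') ≫ X.left.fromSpecResidueField p = x.left := by
    rw [← Spec.map_comp_assoc, hφ', hφ]
  refine ⟨Over.homMk (Spec.map (CommRingCat.ofHom φ') ≫ X.left.fromSpecResidueField p) ?_, ?_⟩
  -- Compatibility with the structure maps can be tested after the injection of the intersection
  -- into `Ka`.
  · obtain ⟨χ, hχ⟩ := Spec.map_surjective
      ((Spec.map (CommRingCat.ofHom φ') ≫ X.left.fromSpecResidueField p) ≫ X.hom)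
    have hw : Spec.map (CommRingCat.ofHom (sInf 𝒮).val.toRingHom) ≫ Spec.map χ =
        Spec.map (CommRingCat.ofHom (algebraMap K Ka)) := by
      rw [hχ, ← Category.assoc, hx]
      exact Over.w x
    rw [← Spec.map_comp, Spec.map_inj] at hw
    refine hχ.symm.trans (congrArg Spec.map ?_)
    refine CommRingCat.hom_ext (RingHom.ext fun a => Subtype.ext ?_)
    exact congrArg (fun f => f.hom a) hw
  · exact Over.OverMorphism.ext hx

end Points

namespace AbelianVarietyWithMul

variable {K : Type u} [Field K] {E : Type v} [Field E] [NumberField E]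
  (A : AbelianVarietyWithMul K E) (Ka : Type u) [Field Ka] [Algebra K Ka] (lam : Ideal (𝓞 E))

/-- All points of `X_λ` are defined over `K(X_λ)`. -/
theorem mem_range_pointsMap_fieldOfDefinition (x : A.Points Ka) (hx : x ∈ A.lamSubmodule Ka lam) :
    x ∈ Set.range (A.pointsMap (A.fieldOfDefinition Ka lam).val) := by
  obtain ⟨y, hy⟩ := exists_specOverMap_sInf A.X x.toMul
    {L : IntermediateField K Ka |
      ∀ x ∈ A.lamSubmodule Ka lam, x ∈ Set.range (A.pointsMap L.val)} fun L hL => by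
    obtain ⟨y, hy⟩ := hL x hx
    exact ⟨y.toMul, congrArg Additive.toMul hy⟩
  exact ⟨Additive.ofMul y, congrArg Additive.ofMul hy⟩

/-- The action of `σ` on `X_λ` depends only on the restriction of `σ` to `K(X_λ)`. -/
theorem galRep_congr {σ τ : Ka ≃ₐ[K] Ka} (h : ∀ a ∈ A.fieldOfDefinition Ka lam, σ a = τ a) :
    A.galRep Ka lam σ = A.galRep Ka lam τ := by
  refine LinearMap.ext fun x => Subtype.ext ?_
  obtain ⟨y, hy⟩ := A.mem_range_pointsMap_fieldOfDefinition Ka lam x.1 x.2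
  change A.pointsMap (σ : Ka →ₐ[K] Ka) x.1 = A.pointsMap (τ : Ka →ₐ[K] Ka) x.1
  rw [← hy, ← LinearMap.comp_apply, ← LinearMap.comp_apply, ← pointsMap_comp, ← pointsMap_comp]
  congr 2
  ext a
  exact h a a.2

end AbelianVarietyWithMul

/-! ### Infinitesimal points of a group scheme at the unit -/

section GroupScheme

variable {K : Type u} [Field K]

theorem specOverMap_injective {R S : Type u} [CommRing R] [Algebra K R] [CommRing S] [Algebra K S] :
    Function.Injective (specOverMap (K := K) (R := R) (S := S)) := fun f g h => by
  have h1 : Spec.map (CommRingCat.ofHom f.toRingHom) = Spec.map (CommRingCat.ofHom g.toRingHom) :=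
    congrArg Over.Hom.left h
  rw [Spec.map_inj] at h1
  exact AlgHom.ext fun a => congrArg (fun f => f.hom a) h1

theorem specOverMap_surjective {R S : Type u} [CommRing R] [Algebra K R] [CommRing S]
    [Algebra K S] : Function.Surjective (specOverMap (K := K) (R := R) (S := S)) := fun f => by
  obtain ⟨φ, hφ⟩ := Spec.map_surjective f.left
  have h : Spec.map φ ≫ Spec.map (CommRingCat.ofHom (algebraMap K R)) =
      Spec.map (CommRingCat.ofHom (algebraMap K S)) := by
    rw [hφ]
    exact Over.w f
  rw [← Spec.map_comp, Spec.map_inj] at h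
  exact ⟨⟨φ.hom, fun r => congrArg (fun f => f.hom r) h⟩, Over.OverMorphism.ext hφ⟩

variable (G : Over (Spec (.of K))) [GrpObj G]

/-- An affine open neighbourhood of the unit section of `G`: a `K`-algebra `A` with an open
immersion `Spec A ⟶ G` through which the unit section factors. -/
structure UnitChart where
  /-- the coordinate ring -/
  A : Type u
  [commRing : CommRing A]
  [algebra : Algebra K A]
  /-- the chart -/
  j : specOver K A ⟶ G
  [isOpenImmersion : IsOpenImmersion j.left]
  /-- the unit section in the chart -/
  ε : A →ₐ[K] K
  specOverMap_ε : specOverMap ε ≫ j = 1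

attribute [instance] UnitChart.commRing UnitChart.algebra UnitChart.isOpenImmersion

namespace UnitChart

variable {G} (c : UnitChart G)

instance : Mono c.j := by
  have : Mono c.j.left := inferInstance
  exact Over.mono_of_mono_left c.j

theorem specOverMap_comp_j_injective {R : Type u} [CommRing R] [Algebra K R] {f g : c.A →ₐ[K] R}
    (h : specOverMap f ≫ c.j = specOverMap g ≫ c.j) : f = g :=
  specOverMap_injective ((cancel_mono c.j).mp h)

theorem specOverMap_ofId_comp_ε (R : Type u) [CommRing R] [Algebra K R] :
    specOverMap ((Algebra.ofId K R).comp c.ε) ≫ c.j = 1 := by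
  rw [specOverMap_comp, Category.assoc, c.specOverMap_ε, MonObj.comp_one]

/-- A point that is trivial modulo a nil ideal factors through the chart. -/
theorem exists_eq_specOverMap_comp_j {R S : Type u} [CommRing R] [Algebra K R] [CommRing S]
    [Algebra K S] (φ : R →ₐ[K] S) (hφ : Function.Surjective φ)
    (hker : RingHom.ker φ ≤ nilradical R) (x : specOver K R ⟶ G) (hx : specOverMap φ ≫ x = 1) :
    ∃ δ : c.A →ₐ[K] R, x = specOverMap δ ≫ c.j := by
  -- Every prime of R comes from S, so `x` topologically lands where the unit does; lifting through
  -- an open immersion depends only on that.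
  have hrange : Set.range x.left ⊆ Set.range c.j.left := by
    rintro _ ⟨p, rfl⟩
    have hp : p ∈ Set.range (PrimeSpectrum.comap φ.toRingHom) := by
      rw [range_comap_of_surjective _ _ hφ]
      intro a ha
      have : p.asIdeal.IsPrime := PrimeSpectrum.isPrime p
      exact nilradical_le_prime p.asIdeal (hker ha)
    obtain ⟨q, rfl⟩ := hp
    have h1 : specOverMap φ ≫ x = specOverMap ((Algebra.ofId K S).comp c.ε) ≫ c.j := by
      rw [hx, c.specOverMap_ofId_comp_ε]
    have h2 := congrArg (fun f : specOver K S ⟶ G => f.left.base q) h1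
    exact ⟨_, h2.symm⟩
  let y := IsOpenImmersion.lift c.j.left x.left hrange
  have hy : y ≫ c.j.left = x.left := IsOpenImmersion.lift_fac _ _ _
  let y' : specOver K R ⟶ specOver K c.A := Over.homMk y (by
    rw [← Over.w c.j, ← Category.assoc, hy, Over.w x])
  obtain ⟨δ, hδ⟩ := specOverMap_surjective y'
  exact ⟨δ, by rw [hδ]; exact Over.OverMorphism.ext hy.symm⟩

open TrivSqZeroExt in
/-- The group law on the points of `K ⊕ (M × M)` that are trivial modulo `M × M`. -/
theorem specOverMap_map_fst_add_snd {M : Type u} [AddCommGroup M] [Module K M] [Module Kᵐᵒᵖ M]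
    [IsCentralScalar K M] (β : c.A →ₐ[K] TrivSqZeroExt K (M × M))
    (hβ : (fstHom K K (M × M)).comp β = c.ε) :
    specOverMap ((map (LinearMap.fst K M M + LinearMap.snd K M M)).comp β) ≫ c.j =
      (specOverMap ((map (LinearMap.fst K M M)).comp β) ≫ c.j) *
        (specOverMap ((map (LinearMap.snd K M M)).comp β) ≫ c.j) := by
  have hzero : specOverMap ((map (0 : M × M →ₗ[K] M)).comp β) ≫ c.j = 1 := by
    rw [← c.specOverMap_ofId_comp_ε, ← hβ]
    congr 2
    ext a <;> simp [Algebra.ofId_apply, algebraMap_eq_inl]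
  -- `b` is the product of the two axis components of `β`. It is trivial modulo M × M, so it is some
  -- `δ` in the chart. Projecting to one factor makes the other component trivial, so `δ` and `β`
  -- have equal projections and coincide. Pushing `b` forward along addition gives the formula.
  let p₁ := LinearMap.inl K M M ∘ₗ LinearMap.fst K M M
  let p₂ := LinearMap.inr K M M ∘ₗ LinearMap.snd K M M
  let b := (specOverMap ((map p₁).comp β) ≫ c.j) * (specOverMap ((map p₂).comp β) ≫ c.j)
  have hb {N : Type u} [AddCommGroup N] [Module K N] [Module Kᵐᵒᵖ N] [IsCentralScalar K N]
      (f : M × M →ₗ[K] N) : specOverMap (map f) ≫ b =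
      (specOverMap ((map (f ∘ₗ p₁)).comp β) ≫ c.j) * (specOverMap ((map (f ∘ₗ p₂)).comp β) ≫ c.j) := by
    simp only [b, MonObj.comp_mul, ← Category.assoc, ← specOverMap_comp, ← AlgHom.comp_assoc,
      ← map_comp_map]
  have hb1 : specOverMap (fstHom K K (M × M)) ≫ b = 1 := by
    simp only [b, MonObj.comp_mul, ← Category.assoc, ← specOverMap_comp, ← AlgHom.comp_assoc]
    have h1 (p : M × M →ₗ[K] M × M) : (fstHom K K (M × M)).comp (map p) = fstHom K K (M × M) := by
      ext <;> simp
    rw [h1, h1, hβ, c.specOverMap_ε, one_mul]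
  obtain ⟨δ, hδ⟩ := c.exists_eq_specOverMap_comp_j (fstHom K K (M × M)) (fun r => ⟨inl r, rfl⟩)
    (fun x hx => by
      rw [mem_nilradical]
      refine ⟨2, ?_⟩
      have hx' : x.fst = 0 := hx
      ext <;> simp [pow_two, hx']) b hb1
  have hfst : (map (LinearMap.fst K M M)).comp δ = (map (LinearMap.fst K M M)).comp β := by
    apply c.specOverMap_comp_j_injective
    rw [specOverMap_comp, Category.assoc, ← hδ, hb]
    have h1 : LinearMap.fst K M M ∘ₗ p₁ = LinearMap.fst K M M := rfl
    have h2 : LinearMap.fst K M M ∘ₗ p₂ = 0 := rfl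
    rw [h1, h2, hzero, mul_one]
  have hsnd : (map (LinearMap.snd K M M)).comp δ = (map (LinearMap.snd K M M)).comp β := by
    apply c.specOverMap_comp_j_injective
    rw [specOverMap_comp, Category.assoc, ← hδ, hb]
    have h1 : LinearMap.snd K M M ∘ₗ p₁ = 0 := rfl
    have h2 : LinearMap.snd K M M ∘ₗ p₂ = LinearMap.snd K M M := rfl
    rw [h1, h2, hzero, one_mul]
  have hδβ : δ = β := by
    refine AlgHom.ext fun a => ?_
    have h1 := congrArg (fun f => f a) hfst
    have h2 := congrArg (fun f => f a) hsnd
    simp only [AlgHom.comp_apply] at h1 h2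
    have h3 := congrArg fst h1
    have h4 := congrArg snd h1
    have h5 := congrArg snd h2
    simp only [fst_map, snd_map] at h3 h4 h5
    exact TrivSqZeroExt.ext h3 (Prod.ext h4 h5)
  rw [specOverMap_comp, Category.assoc, ← hδβ, ← hδ, hb, hδβ]
  have h1 : (LinearMap.fst K M M + LinearMap.snd K M M) ∘ₗ p₁ = LinearMap.fst K M M := by
    ext <;> simp [p₁]
  have h2 : (LinearMap.fst K M M + LinearMap.snd K M M) ∘ₗ p₂ = LinearMap.snd K M M := by
    ext <;> simp [p₂]
  rw [h1, h2]

open TrivSqZeroExt in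
/-- Powers of a point of `K ⊕ M` that is trivial modulo `M`. -/
theorem specOverMap_comp_j_pow {M : Type u} [AddCommGroup M] [Module K M] [Module Kᵐᵒᵖ M]
    [IsCentralScalar K M] (β : c.A →ₐ[K] TrivSqZeroExt K M)
    (hβ : (fstHom K K M).comp β = c.ε) (n : ℕ) :
    (specOverMap β ≫ c.j) ^ n =
      specOverMap ((map (n • LinearMap.id : M →ₗ[K] M)).comp β) ≫ c.j := by
  induction n with
  | zero =>
    rw [pow_zero, ← c.specOverMap_ofId_comp_ε, ← hβ]
    congr 2
    ext a <;> simp [Algebra.ofId_apply, algebraMap_eq_inl]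
  | succ n ih =>
    -- Addition composed with (n·id, id) is (n + 1)·id, so the previous lemma yields the induction
    -- step.
    let q : M →ₗ[K] M × M := (n • LinearMap.id : M →ₗ[K] M).prod LinearMap.id
    have h := c.specOverMap_map_fst_add_snd ((map q).comp β) (by
      rw [← hβ]
      ext
      simp)
    simp only [← AlgHom.comp_assoc, ← map_comp_map] at h
    have h1 : LinearMap.fst K M M ∘ₗ q = n • LinearMap.id := rfl
    have h2 : LinearMap.snd K M M ∘ₗ q = LinearMap.id := rfl
    have h3 : (LinearMap.fst K M M + LinearMap.snd K M M) ∘ₗ q = (n + 1) • LinearMap.id := by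
      ext; simp [q, add_smul]
    rw [h1, h2, h3, map_id, AlgHom.id_comp, ← ih, ← pow_succ] at h
    exact h.symm

end UnitChart

/-- The unit section has an affine open neighbourhood. -/
theorem nonempty_unitChart : Nonempty (UnitChart G) := by
  let e : specOver K K ⟶ G := 1
  let p : G.left := e.left (IsLocalRing.closedPoint K)
  obtain ⟨_, ⟨U, hU, rfl⟩, hpU, -⟩ :=
    G.left.isBasis_affineOpens.exists_subset_of_mem_open (Set.mem_univ p) isOpen_univ
  obtain ⟨f, hf⟩ := Spec.map_surjective (hU.fromSpec ≫ G.hom)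
  let : Algebra K Γ(G.left, U) := f.hom.toAlgebra
  let j : specOver K Γ(G.left, U) ⟶ G := Over.homMk hU.fromSpec hf.symm
  have : IsOpenImmersion j.left := hU.isOpenImmersion_fromSpec
  have hrange : Set.range e.left ⊆ Set.range j.left := by
    rintro _ ⟨q, rfl⟩
    have hq : q = IsLocalRing.closedPoint K :=
      Subsingleton.elim (α := PrimeSpectrum K) _ _
    rw [hq]
    exact hU.range_fromSpec.symm ▸ hpU
  let y := IsOpenImmersion.lift j.left e.left hrange
  have hy : y ≫ j.left = e.left := IsOpenImmersion.lift_fac _ _ _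
  let y' : specOver K K ⟶ specOver K Γ(G.left, U) := Over.homMk y (by
    rw [← Over.w j, ← Category.assoc, hy, Over.w e])
  obtain ⟨ε, hε⟩ := specOverMap_surjective y'
  exact ⟨{ A := Γ(G.left, U), j := j, ε := ε,
           specOverMap_ε := by rw [hε]; exact Over.OverMorphism.ext hy }⟩

variable {G} in
/-- A point of `G` that is trivial modulo a square-zero ideal and killed by an invertible integer
is trivial. -/
theorem GrpObj.point_eq_one_of_pow_eq_one {R S : Type u} [CommRing R] [Algebra K R] [CommRing S]
    [Algebra K S] (φ : R →ₐ[K] S) (hφ : Function.Surjective φ)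
    (hker : RingHom.ker φ ^ 2 = ⊥) (x : specOver K R ⟶ G) (hx : specOverMap φ ≫ x = 1)
    (n : ℕ) (hn : (n : K) ≠ 0) (hxn : x ^ n = 1) : x = 1 := by
  obtain ⟨c⟩ := nonempty_unitChart G
  have hmul (a b : R) (ha : a ∈ RingHom.ker φ) (hb : b ∈ RingHom.ker φ) : a * b = 0 := by
    have h := Ideal.mul_mem_mul ha hb
    rwa [← pow_two, hker, Ideal.mem_bot] at h
  obtain ⟨δ, rfl⟩ := c.exists_eq_specOverMap_comp_j φ hφ
    (fun a ha => ⟨2, by rw [pow_two]; exact hmul a a ha ha⟩) x hx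
  have hδ : φ.comp δ = (Algebra.ofId K S).comp c.ε := by
    apply c.specOverMap_comp_j_injective
    rw [specOverMap_comp, Category.assoc, hx, c.specOverMap_ofId_comp_ε]
  let M := (RingHom.ker φ).restrictScalars K
  let : Module Kᵐᵒᵖ M := Module.compHom M ((RingHom.id K).fromOpposite mul_comm)
  have : IsCentralScalar K M := ⟨fun _ _ => rfl⟩
  have hop (r : K) (x : M) : MulOpposite.op r • x = r • x := rfl
  -- Since ker φ has square zero, D = δ - ε is a derivation along ε. So δ factors through K ⊕ M as
  -- `ψ.comp β`, where the n-th power of the point is ε + nD. Triviality of that power gives nD = 0,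
  -- hence D = 0.
  let D : c.A →ₗ[K] M := (δ.toLinearMap - ((Algebra.ofId K R).comp c.ε).toLinearMap).codRestrict M
    fun a => by
      have := congrArg (fun f => f a) hδ
      simp only [AlgHom.comp_apply, Algebra.ofId_apply] at this
      change φ _ = 0
      simp [Algebra.ofId_apply, this]
  have hD (a) : (D a : R) = δ a - algebraMap K R (c.ε a) := rfl
  have hDmul (a b) : D (a * b) = c.ε a • D b + c.ε b • D a := by
    have h1 := hmul _ _ (D a).2 (D b).2
    refine Subtype.ext ?_
    simp only [Submodule.coe_add, Submodule.coe_smul, Algebra.smul_def, hD, map_mul] at h1 ⊢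
    linear_combination h1
  let β : c.A →ₐ[K] TrivSqZeroExt K M := AlgHom.ofLinearMap
    ((TrivSqZeroExt.inlAlgHom K K M).toLinearMap ∘ₗ c.ε.toLinearMap +
      TrivSqZeroExt.inrHom K M ∘ₗ D)
    (by
      have h1 : D 1 = 0 := Subtype.ext (by simp [hD])
      simp [h1])
    (fun a b => by
      ext <;> simp [hDmul, hop])
  have hβ : (TrivSqZeroExt.fstHom K K M).comp β = c.ε := by
    ext a; simp [β]
  let ψ : TrivSqZeroExt K M →ₐ[K] R := TrivSqZeroExt.liftEquivOfComm
    ⟨M.subtype, fun x y => hmul _ _ x.2 y.2⟩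
  have hψ (a) :
      ψ (TrivSqZeroExt.map (n • LinearMap.id : M →ₗ[K] M) (β a)) =
        algebraMap K R (c.ε a) + (n : K) • (D a : R) := by
    simp [ψ, β, TrivSqZeroExt.lift_def, Algebra.ofId_apply, Algebra.smul_def]
  have hψβ : ψ.comp β = δ := by
    ext a
    simp [ψ, β, TrivSqZeroExt.lift_def, Algebra.ofId_apply, hD]
  have hpow := c.specOverMap_comp_j_pow β hβ n
  have hxn' : specOverMap (ψ.comp ((TrivSqZeroExt.map (n • LinearMap.id : M →ₗ[K] M)).comp β)) ≫
      c.j = specOverMap ((Algebra.ofId K R).comp c.ε) ≫ c.j := by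
    rw [specOverMap_comp, Category.assoc, ← hpow, MonObj.comp_pow, ← Category.assoc,
      ← specOverMap_comp, hψβ, hxn, c.specOverMap_ofId_comp_ε]
  have hδ : δ = (Algebra.ofId K R).comp c.ε := by
    refine AlgHom.ext fun a => ?_
    have h1 := congrArg (fun f => f a) (c.specOverMap_comp_j_injective hxn')
    simp only [AlgHom.comp_apply, hψ, Algebra.ofId_apply, add_eq_left] at h1
    have h3 : (D a : R) = 0 := by
      rw [← one_smul K (D a : R), ← inv_mul_cancel₀ hn, mul_smul, h1, smul_zero]
    rw [hD, sub_eq_zero] at h3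
    exact h3
  rw [hδ, c.specOverMap_ofId_comp_ε]

end GroupScheme

/-! ### Multiplication by n is unramified, and its kernel is finite -/

section Torsion

/-- Unramified morphisms are locally quasi-finite. -/
theorem locallyQuasiFinite_of_formallyUnramified {X Y : Scheme.{u}} (f : X ⟶ Y)
    [FormallyUnramified f] [LocallyOfFiniteType f] : LocallyQuasiFinite f where
  quasiFinite_appLE {U} hU {V} hV e := by
    let := (f.appLE U V e).hom.toAlgebra
    have h₁ : Algebra.FormallyUnramified Γ(Y, U) Γ(X, V) := f.formallyUnramified_appLE hU hV e
    have h₂ : Algebra.FiniteType Γ(Y, U) Γ(X, V) := f.finiteType_appLE hU hV e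
    exact inferInstanceAs (Algebra.QuasiFinite Γ(Y, U) Γ(X, V))

variable {K : Type u} [Field K]

/-- A finite `K`-scheme has finitely many points in each field extension. -/
theorem finite_points_of_isFinite {X : Scheme.{u}} (f : X ⟶ Spec (.of K)) [IsFinite f]
    (F : Type u) [Field F] [Algebra K F] :
    Finite {x : Spec (.of F) ⟶ X // x ≫ f = Spec.map (CommRingCat.ofHom (algebraMap K F))} := by
  have : IsAffine X := isAffine_of_isAffineHom f
  obtain ⟨θ, hθ⟩ := Spec.map_surjective (X.isoSpec.inv ≫ f)
  have hfin : IsFinite (Spec.map θ) := by rw [hθ]; infer_instance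
  rw [IsFinite.SpecMap_iff] at hfin
  let : Algebra K Γ(X, ⊤) := θ.hom.toAlgebra
  have : Module.Finite K Γ(X, ⊤) := hfin
  let Φ (g : Γ(X, ⊤) →ₐ[K] F) : Spec (.of F) ⟶ X :=
    Spec.map (CommRingCat.ofHom g.toRingHom) ≫ X.isoSpec.inv
  refine (Set.finite_range Φ).subset fun x hx => ?_
  obtain ⟨ψ, hψ⟩ := Spec.map_surjective (x ≫ X.isoSpec.hom)
  have h1 : Spec.map ψ ≫ Spec.map θ = Spec.map (CommRingCat.ofHom (algebraMap K F)) := by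
    rw [hψ, hθ, Category.assoc, Iso.hom_inv_id_assoc]
    exact hx
  rw [← Spec.map_comp, Spec.map_inj] at h1
  refine ⟨⟨ψ.hom, fun r => congrArg (fun f => f.hom r) h1⟩, ?_⟩
  change Spec.map ψ ≫ X.isoSpec.inv = x
  rw [hψ, Category.assoc, Iso.hom_inv_id, Category.comp_id]

variable (G : Over (Spec (.of K))) [GrpObj G] [IsCommMonObj G] (n : ℕ)

/-- Multiplication by an invertible integer on a commutative group scheme is unramified. -/
theorem formallyUnramified_pow_left (hn : (n : K) ≠ 0) :
    FormallyUnramified ((𝟙 G) ^ n : G ⟶ G).left := by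
  refine .of_hom_ext _ fun R S φ hφ hker g₁ g₂ hg hgn => ?_
  obtain ⟨f, hf⟩ := Spec.map_surjective (g₁ ≫ G.hom)
  -- The structure comes from `g₁`; `g₂` induces the same one because both agree after
  -- multiplication by n, a morphism over K.
  let : Algebra K R := f.hom.toAlgebra
  let : Algebra K S := (f ≫ φ).hom.toAlgebra
  let φ' : R →ₐ[K] S := ⟨φ.hom, fun _ => rfl⟩
  let x₁ : specOver K R ⟶ G := Over.homMk g₁ hf.symm
  let x₂ : specOver K R ⟶ G := Over.homMk g₂ (by
    have h := congrArg (fun g => g ≫ G.hom) hgn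
    simp only [Category.assoc, Over.w] at h
    exact h.symm.trans hf.symm)
  have hx : specOverMap φ' ≫ x₁ = specOverMap φ' ≫ x₂ := Over.OverMorphism.ext hg
  have hxn : x₁ ^ n = x₂ ^ n := by
    have h : x₁ ≫ (𝟙 G) ^ n = x₂ ≫ (𝟙 G) ^ n := Over.OverMorphism.ext hgn
    rwa [MonObj.comp_pow, MonObj.comp_pow, Category.comp_id, Category.comp_id] at h
  -- By commutativity the quotient of the two lifts is killed by n, and it is trivial modulo the
  -- square-zero ideal.
  have h1 : x₁ / x₂ = 1 := GrpObj.point_eq_one_of_pow_eq_one φ' hφ hker _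
    (by rw [GrpObj.comp_div, hx, div_self']) n hn (by rw [div_pow, hxn, div_self'])
  exact congrArg Over.Hom.left (div_eq_one.mp h1)

/-- A proper commutative group scheme has only finitely many torsion points of an order that is
invertible in the base field. -/
theorem finite_torsion_points [IsProper G.hom] (hn : (n : K) ≠ 0)
    (F : Type u) [Field F] [Algebra K F] : {x : specOver K F ⟶ G | x ^ n = 1}.Finite := by
  let m : G ⟶ G := (𝟙 G) ^ n
  let e : Spec (.of K) ⟶ G.left := (1 : specOver K K ⟶ G).left
  have : FormallyUnramified m.left := formallyUnramified_pow_left G n hn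
  have : IsProper (m.left ≫ G.hom) := by rw [Over.w]; infer_instance
  have : IsProper m.left := .of_comp m.left G.hom
  -- The kernel of multiplication by n, over K: proper, and unramified hence quasi-finite, so
  -- finite.
  let p := Limits.pullback.snd m.left e
  have hst : MorphismProperty.IsStableUnderBaseChange @FormallyUnramified.{u} := inferInstance
  have : FormallyUnramified p :=
    hst.of_isPullback (IsPullback.of_hasPullback m.left e) inferInstance
  have : LocallyQuasiFinite p := locallyQuasiFinite_of_formallyUnramified p
  have : IsFinite p := .of_locallyQuasiFinite p
  have hfin := finite_points_of_isFinite p F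
  let Φ (y : {y : Spec (.of F) ⟶ Limits.pullback m.left e //
      y ≫ p = Spec.map (CommRingCat.ofHom (algebraMap K F))}) : Spec (.of F) ⟶ G.left :=
    y.1 ≫ Limits.pullback.fst m.left e
  have hinj : Function.Injective fun x : specOver K F ⟶ G => (x.left : Spec (.of F) ⟶ G.left) :=
    fun _ _ h => Over.OverMorphism.ext h
  refine Set.Finite.of_finite_image ((Set.finite_range Φ).subset ?_) hinj.injOn
  rintro _ ⟨x, hx, rfl⟩
  have h1 : x ≫ m = specOverMap (Algebra.ofId K F) ≫ 1 := by
    rw [MonObj.comp_pow, Category.comp_id, hx, MonObj.comp_one]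
  have h2 : x.left ≫ m.left = Spec.map (CommRingCat.ofHom (algebraMap K F)) ≫ e :=
    congrArg Over.Hom.left h1
  exact ⟨⟨Limits.pullback.lift _ _ h2, Limits.pullback.lift_snd _ _ h2⟩,
    Limits.pullback.lift_fst _ _ h2⟩

end Torsion

/-! ### Finiteness of X_λ and the conclusion -/

namespace AbelianVarietyWithMul

variable {K : Type u} [Field K] {E : Type v} [Field E] [NumberField E]

/-- `X_λ` is finite if the residue characteristic of `λ` is invertible in `K`. -/
theorem finite_lam (A : AbelianVarietyWithMul K E) (Ka : Type u) [Field Ka] [Algebra K Ka]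
    (lam : Ideal (𝓞 E)) (n : ℕ) (hn : (n : 𝓞 E) ∈ lam) (hnK : (n : K) ≠ 0) :
    Finite (A.Lam Ka lam) := by
  have h := finite_torsion_points A.X n hnK Ka
  refine Set.Finite.subset (s := {x : A.Points Ka | x.toMul ^ n = 1}) ?_ fun x hx => ?_
  · exact h.preimage Additive.toMul.injective.injOn
  · have h1 : (n : 𝓞 E) • x = 0 := (Submodule.mem_torsionBySet_iff _ _).mp hx ⟨_, hn⟩
    rw [Nat.cast_smul_eq_nsmul] at h1
    exact congrArg Additive.toMul h1

end AbelianVarietyWithMul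

end

theorem mainTheorem6 {K : Type u} [Field K] {Ka : Type u} [Field Ka] [Algebra K Ka]
    [IsAlgClosure K Ka] {E : Type v} [Field E] [NumberField E]
    (lam : Ideal (𝓞 E)) (hlam : lam.IsMaximal) (ℓ : ℕ) (hℓ : CharP (𝓞 E ⧸ lam) ℓ)
    (honly : ∀ P : Ideal (𝓞 E), P.IsMaximal → (ℓ : 𝓞 E) ∈ P → P = lam)
    (hchar : ringChar K ≠ ℓ)
    (X Y : AbelianVarietyWithMul K E) (hX : 0 < X.dim) (hY : 0 < Y.dim)
    (hdisj : (X.fieldOfDefinition Ka lam).LinearDisjoint (Y.fieldOfDefinition Ka lam))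
    (hk₁ : IsField (X.galCentralizer Ka lam)) (hk₂ : IsField (Y.galCentralizer Ka lam))
    (hk : LinearlyDisjointOver (𝓞 E ⧸ lam) (X.galCentralizer Ka lam) (Y.galCentralizer Ka lam)) :
    X.DisjointAt Y Ka lam := by
  let := Ideal.Quotient.field lam
  have hmem : (ℓ : 𝓞 E) ∈ lam := by
    rw [← Ideal.Quotient.eq_zero_iff_mem, map_natCast]
    exact CharP.cast_eq_zero _ ℓ
  have hlam0 : lam ≠ ⊥ :=
    Ring.ne_bot_of_isMaximal_of_not_isField hlam (NumberField.RingOfIntegers.not_isField E)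
  have : Finite (𝓞 E ⧸ lam) := Ideal.finiteQuotientOfFreeOfNeBot lam hlam0
  have hprime : ℓ.Prime := (CharP.char_is_prime_or_zero (𝓞 E ⧸ lam) ℓ).resolve_right
    (CharP.char_ne_zero_of_finite (𝓞 E ⧸ lam) ℓ)
  have hℓK : (ℓ : K) ≠ 0 := fun h => by
    have hdvd := ringChar.dvd h
    rcases (Nat.dvd_prime hprime).mp hdvd with h1 | h1
    · exact CharP.ringChar_ne_one h1
    · exact hchar h1
  have := X.finite_lam Ka lam ℓ hmem hℓK
  have := Y.finite_lam Ka lam ℓ hmem hℓK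
  have : FiniteDimensional (𝓞 E ⧸ lam) (X.Lam Ka lam) := Module.Finite.of_finite
  have : FiniteDimensional (𝓞 E ⧸ lam) (Y.Lam Ka lam) := Module.Finite.of_finite
  refine isField_centralizer_linHom (X.galRep Ka lam) (Y.galRep Ka lam) (fun σ τ => ?_) hk₁ hk₂ hk
  obtain ⟨g, hg₁, hg₂⟩ := hdisj.exists_algEquiv_eqOn σ τ
  exact ⟨g, X.galRep_congr Ka lam hg₁, Y.galRep_congr Ka lam hg₂⟩
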